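/- Let $(X,d,\bar x)$ be a separable pointed metric space, let $\{x_n : n\in\mathbb N\}$ be a countable dense subset of $X$ with $x_0=\bar x$, let $M_n=\{x_0,x_1,\dots,x_n\}$ for $n\in\mathbb N$, and let $1\le K<\infty$. For a pointed metric space $(Y,d,\bar x)$ let $\mathrm{Lip}_0(Y)$ be the space of real-valued Lipschitz functions on $Y$ vanishing at $\bar x$, normed by $\|f\|_{\mathrm{Lip}_0(Y)}=\sup_{x\ne y}|f(x)-f(y)|/d(x,y)$; let $\delta_x\in \mathrm{Lip}_0(Y)^*$ be $f\mapsto f(x)$, and let $\mathcal F(Y)$ be the norm closure of $\mathrm{span}\{\delta_x : x\in Y\}$ in $\mathrm{Lip}_0(Y)^*$. For $\mu,\nu\in\mathcal F(Y)$ put $W_1(\mu,\nu)=\sup\{\mu(g)-\nu(g) : g\in \mathrm{Lip}_0(Y),\ \|g\|_{\mathrm{Lip}_0(Y)}\le 1\}=\|\mu-\nu\|_{\mathcal F(Y)}$. Each $M_n$ carries the base point $\bar x$, and $\mathcal F(M_n)$ is regarded as a subspace of $\mathcal F(X)$ via $\mu\mapsto (f\mapsto \mu(f|_{M_n}))$.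 A Banach space $E$ has the $K$-bounded approximation property ($K$-BAP) if for every $\varepsilon>0$ and every compact $S\subseteq E$ there is a bounded finite-rank linear operator $T:E\to E$ with $\|T\|\le K$ and $\|Tx-x\|\le\varepsilon$ for all $x\in S$. Theorem. The following are equivalent: (a) $\mathcal F(X)$ has the $K$-BAP; (b) $X$ admits an asymptotic $K$-random projection on $(M_n)_n$, i.e. for every $n\in\mathbb N$ there is a family $\{\upsilon^n_x : x\in X\}\subseteq \mathcal F(M_n)$ such that (i) $\lim_{n\to\infty} W_1(\upsilon^n_x,\delta_x)=0$ for every $x\in\bigcup_n M_n$ (the distance being taken in $\mathcal F(X)$); (ii) $W_1(\upsilon^n_x,\upsilon^n_y)\le K\,d(x,y)$ for all $x,y\in X$ and all $n\in\mathbb N$ (the distance being taken in $\mathcal F(M_n)$). -/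

import Mathlib

open Filter Topology

noncomputable section

/-- The real-valued Lipschitz functions on the pointed metric space `(X, x₀)` that vanish at the
base point, as a linear subspace of all functions. -/
def lipZeroSubmodule {X : Type*} [MetricSpace X] (x₀ : X) : Submodule ℝ (X → ℝ) where
  carrier := {f | f x₀ = 0 ∧ ∃ C : ℝ, ∀ x y, |f x - f y| ≤ C * dist x y}
  zero_mem' := ⟨rfl, 0, fun x y => by simp⟩
  add_mem' := by
    rintro f g ⟨hf0, C, hC⟩ ⟨hg0, D, hD⟩
    refine ⟨by simp [hf0, hg0], C + D, fun x y => ?_⟩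
    calc |(f + g) x - (f + g) y| = |(f x - f y) + (g x - g y)| := by
          simp only [Pi.add_apply]; ring_nf
      _ ≤ |f x - f y| + |g x - g y| := abs_add_le _ _
      _ ≤ (C + D) * dist x y := by linarith [hC x y, hD x y]
  smul_mem' := by
    rintro c f ⟨hf0, C, hC⟩
    refine ⟨by simp [hf0], |c| * C, fun x y => ?_⟩
    have h : (c • f) x - (c • f) y = c * (f x - f y) := by
      simp only [Pi.smul_apply, smul_eq_mul]; ring
    rw [h, abs_mul, mul_assoc]
    exact mul_le_mul_of_nonneg_left (hC x y) (abs_nonneg c)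

/-- The space `Lip₀(X)` of real-valued Lipschitz functions vanishing at `x₀`. -/
def LipZero (X : Type*) [MetricSpace X] (x₀ : X) : Type _ := lipZeroSubmodule x₀

namespace LipZero

variable {X : Type*} [MetricSpace X] {x₀ : X}

instance : AddCommGroup (LipZero X x₀) := inferInstanceAs (AddCommGroup (lipZeroSubmodule x₀))

instance : Module ℝ (LipZero X x₀) := inferInstanceAs (Module ℝ (lipZeroSubmodule x₀))

instance : CoeFun (LipZero X x₀) (fun _ => X → ℝ) := ⟨fun f => f.1⟩

theorem ext_fun {f g : LipZero X x₀} (h : ∀ x, f x = g x) : f = g := Subtype.ext (funext h)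

theorem apply_base (f : LipZero X x₀) : f x₀ = 0 := f.2.1

@[simp] theorem zero_apply (x : X) : (0 : LipZero X x₀) x = 0 := rfl

@[simp] theorem add_apply (f g : LipZero X x₀) (x : X) : (f + g) x = f x + g x := rfl

@[simp] theorem smul_apply (c : ℝ) (f : LipZero X x₀) (x : X) : (c • f) x = c * f x := rfl

/-- The norm of `Lip₀(X)` is the best Lipschitz constant: the supremum of
`|f x - f y| / d(x, y)` over all pairs `x ≠ y`. -/
instance : Norm (LipZero X x₀) :=
  ⟨fun f => sSup {r : ℝ | ∃ x y : X, x ≠ y ∧ r = |f x - f y| / dist x y}⟩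

theorem norm_def (f : LipZero X x₀) :
    ‖f‖ = sSup {r : ℝ | ∃ x y : X, x ≠ y ∧ r = |f x - f y| / dist x y} := rfl

theorem norm_nonneg' (f : LipZero X x₀) : 0 ≤ ‖f‖ := by
  rw [norm_def]
  apply Real.sSup_nonneg
  rintro r ⟨x, y, -, rfl⟩
  positivity

theorem abs_sub_le (f : LipZero X x₀) (x y : X) : |f x - f y| ≤ ‖f‖ * dist x y := by
  rcases eq_or_ne x y with rfl | hxy
  · simp
  · have hd : 0 < dist x y := dist_pos.2 hxy
    rw [← div_le_iff₀ hd, norm_def]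
    refine le_csSup ?_ ⟨x, y, hxy, rfl⟩
    obtain ⟨C, hC⟩ := f.2.2
    refine ⟨C, ?_⟩
    rintro r ⟨a, b, hab, rfl⟩
    exact (div_le_iff₀ (dist_pos.2 hab)).2 (hC a b)

theorem norm_le_of {f : LipZero X x₀} {C : ℝ} (hC : 0 ≤ C)
    (h : ∀ x y, |f x - f y| ≤ C * dist x y) : ‖f‖ ≤ C := by
  rw [norm_def]
  refine Real.sSup_le ?_ hC
  rintro r ⟨a, b, hab, rfl⟩
  exact (div_le_iff₀ (dist_pos.2 hab)).2 (h a b)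

theorem norm_smul_le' (c : ℝ) (f : LipZero X x₀) : ‖c • f‖ ≤ |c| * ‖f‖ := by
  refine norm_le_of (mul_nonneg (abs_nonneg c) (norm_nonneg' f)) fun x y => ?_
  rw [smul_apply, smul_apply, ← mul_sub, abs_mul, mul_assoc]
  exact mul_le_mul_of_nonneg_left (abs_sub_le f x y) (abs_nonneg c)

theorem norm_core : NormedSpace.Core ℝ (LipZero X x₀) where
  norm_nonneg := norm_nonneg'
  norm_smul c f := by
    refine le_antisymm (norm_smul_le' c f) ?_
    rcases eq_or_ne c 0 with rfl | hc
    · simpa using norm_nonneg' _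
    · have h := norm_smul_le' c⁻¹ (c • f)
      rw [smul_smul, inv_mul_cancel₀ hc, one_smul, abs_inv] at h
      have hc' : 0 < |c| := abs_pos.2 hc
      rw [Real.norm_eq_abs]
      calc |c| * ‖f‖ ≤ |c| * (|c|⁻¹ * ‖c • f‖) := mul_le_mul_of_nonneg_left h hc'.le
        _ = ‖c • f‖ := by rw [← mul_assoc, mul_inv_cancel₀ hc'.ne', one_mul]
  norm_triangle f g := by
    refine norm_le_of (add_nonneg (norm_nonneg' f) (norm_nonneg' g)) fun x y => ?_
    calc |(f + g) x - (f + g) y| = |(f x - f y) + (g x - g y)| := by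
          simp only [add_apply]; ring_nf
      _ ≤ |f x - f y| + |g x - g y| := abs_add_le _ _
      _ ≤ (‖f‖ + ‖g‖) * dist x y := by linarith [abs_sub_le f x y, abs_sub_le g x y]
  norm_eq_zero_iff f := by
    constructor
    · intro h
      refine ext_fun fun x => ?_
      have := abs_sub_le f x x₀
      rw [h, zero_mul, apply_base, sub_zero] at this
      simpa using abs_nonpos_iff.1 this
    · rintro rfl
      exact le_antisymm (norm_le_of le_rfl fun x y => by simp) (norm_nonneg' _)

instance : NormedAddCommGroup (LipZero X x₀) := NormedAddCommGroup.ofCore norm_core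

instance : NormedSpace ℝ (LipZero X x₀) := NormedSpace.ofCore norm_core

/-- The restriction operator `Lip₀(X) → Lip₀(M)` for a subset `M` containing the base point. -/
def restrict (M : Set X) (hM : x₀ ∈ M) : LipZero X x₀ →L[ℝ] LipZero M ⟨x₀, hM⟩ :=
  LinearMap.mkContinuous
    { toFun := fun f => ⟨fun x => f x.1, f.2.1, f.2.2.imp fun _ hC x y => hC x.1 y.1⟩
      map_add' := fun _ _ => rfl
      map_smul' := fun _ _ => rfl } 1
    (fun f => by
      rw [one_mul]
      exact norm_le_of (norm_nonneg' f) fun x y => abs_sub_le f x.1 y.1)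

/-- The Dirac functional `δ_x`, i.e. `f ↦ f x`, in the dual of `Lip₀(X)`. -/
def evalDual (x₀ x : X) : StrongDual ℝ (LipZero X x₀) :=
  LinearMap.mkContinuous
    { toFun := fun f => f x
      map_add' := fun _ _ => rfl
      map_smul' := fun _ _ => rfl } (dist x x₀)
    (fun f => by
      have h := abs_sub_le f x x₀
      rw [apply_base, sub_zero] at h
      rw [mul_comm]
      exact h)

end LipZero

/-- The free (Arens-Eells) space `𝓕(X)` of the pointed metric space `(X, x₀)`: the norm closure of
the span of the Dirac functionals in the dual of `Lip₀(X)`, with the dual norm. -/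
abbrev FreeSpace (X : Type*) [MetricSpace X] (x₀ : X) : Type _ :=
  (Submodule.span ℝ (Set.range (LipZero.evalDual x₀))).topologicalClosure

namespace FreeSpace

variable {X : Type*} [MetricSpace X]

/-- The Dirac map `δ : X → 𝓕(X)`. -/
def delta (x₀ x : X) : FreeSpace X x₀ :=
  ⟨LipZero.evalDual x₀ x, Submodule.le_topologicalClosure _ (Submodule.subset_span ⟨x, rfl⟩)⟩

/-- The canonical map `𝓕(M) → 𝓕(X)` for a subset `M` containing the base point, the pre-adjoint
of restriction: `(incl μ)(f) = μ(f|_M)`. -/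
def incl {x₀ : X} (M : Set X) (hM : x₀ ∈ M) (μ : FreeSpace M ⟨x₀, hM⟩) : FreeSpace X x₀ :=
  ⟨μ.1.comp (LipZero.restrict M hM), by
    let Φ : StrongDual ℝ (LipZero M ⟨x₀, hM⟩) →L[ℝ] StrongDual ℝ (LipZero X x₀) :=
      (ContinuousLinearMap.compL ℝ (LipZero X x₀) (LipZero M ⟨x₀, hM⟩) ℝ).flip
        (LipZero.restrict M hM)
    have hμ : μ.1 ∈ closure
        (Submodule.span ℝ (Set.range (LipZero.evalDual (⟨x₀, hM⟩ : M))) : Set _) := μ.2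
    have hmaps : Set.MapsTo Φ
        (Submodule.span ℝ (Set.range (LipZero.evalDual (⟨x₀, hM⟩ : M))) : Set _)
        (Submodule.span ℝ (Set.range (LipZero.evalDual x₀)) : Set _) := by
      have hle : Submodule.span ℝ (Set.range (LipZero.evalDual (⟨x₀, hM⟩ : M))) ≤
          (Submodule.span ℝ (Set.range (LipZero.evalDual x₀))).comap Φ.toLinearMap := by
        rw [Submodule.span_le]
        rintro _ ⟨x, rfl⟩
        exact Submodule.subset_span ⟨x.1, rfl⟩
      exact fun a ha => hle ha
    have hcl : Φ μ.1 ∈ closure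
        (Submodule.span ℝ (Set.range (LipZero.evalDual x₀)) : Set _) :=
      map_mem_closure Φ.continuous hμ hmaps
    exact hcl⟩

/-- The Kantorovich-Rubinstein (Wasserstein) distance of order one on `𝓕(X)`:
the supremum of `μ(g) - ν(g)` over `g` in the unit ball of `Lip₀(X)`. -/
def W₁ {x₀ : X} (μ ν : FreeSpace X x₀) : ℝ :=
  sSup {r : ℝ | ∃ g : LipZero X x₀, ‖g‖ ≤ 1 ∧ r = μ.1 g - ν.1 g}

/-- The set whose supremum is `W₁ μ ν` is non-empty and bounded, and `W₁` is the distance induced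
by the norm of the free space. -/
theorem W₁_eq_norm {x₀ : X} (μ ν : FreeSpace X x₀) : W₁ μ ν = ‖μ - ν‖ := by
  have hb : ∀ r ∈ {r : ℝ | ∃ g : LipZero X x₀, ‖g‖ ≤ 1 ∧ r = μ.1 g - ν.1 g}, r ≤ ‖μ - ν‖ := by
    rintro r ⟨g, hg, rfl⟩
    calc μ.1 g - ν.1 g = (μ.1 - ν.1) g := rfl
      _ ≤ ‖(μ.1 - ν.1) g‖ := le_abs_self _
      _ ≤ ‖μ.1 - ν.1‖ * ‖g‖ := ContinuousLinearMap.le_opNorm _ _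
      _ ≤ ‖μ.1 - ν.1‖ * 1 := by gcongr
      _ = ‖μ - ν‖ := by rw [mul_one]; rfl
  have h0 : 0 ≤ W₁ μ ν := le_csSup ⟨_, hb⟩ ⟨0, by simp, by simp⟩
  refine le_antisymm (csSup_le ⟨0, 0, by simp, by simp⟩ hb) ?_
  have key : ∀ g : LipZero X x₀, (μ.1 - ν.1) g ≤ W₁ μ ν * ‖g‖ := by
    intro g
    rcases eq_or_ne g 0 with rfl | hg
    · simp
    · have hg' : 0 < ‖g‖ := norm_pos_iff.2 hg
      have h1 : (μ.1 - ν.1) (‖g‖⁻¹ • g) ≤ W₁ μ ν :=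
        le_csSup ⟨_, hb⟩ ⟨‖g‖⁻¹ • g, by
          rw [norm_smul, norm_inv, norm_norm, inv_mul_cancel₀ hg'.ne'], rfl⟩
      rw [map_smul, smul_eq_mul, inv_mul_le_iff₀ hg'] at h1
      linarith
  refine ContinuousLinearMap.opNorm_le_bound (μ.1 - ν.1) h0 fun g => ?_
  rw [Real.norm_eq_abs, abs_le]
  refine ⟨?_, key g⟩
  have h := key (-g)
  rw [map_neg, norm_neg] at h
  linarith

end FreeSpace

/-- The `K`-bounded approximation property of a real normed space `E`: on every compact set the
identity is uniformly approximated by finite-rank bounded operators of norm at most `K`. -/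
def HasBAP (E : Type*) [NormedAddCommGroup E] [NormedSpace ℝ E] (K : ℝ) : Prop :=
  ∀ ε : ℝ, 0 < ε → ∀ S : Set E, IsCompact S →
    ∃ T : E →L[ℝ] E, FiniteDimensional ℝ (LinearMap.range (T : E →ₗ[ℝ] E)) ∧
      ‖T‖ ≤ K ∧ ∀ x ∈ S, ‖T x - x‖ ≤ ε

/-- `(X, x₀)` admits an asymptotic `K`-random projection on the sequence `M` of subsets containing
the base point. The first distance is taken in `𝓕(X)`, the second one in `𝓕(M n)`. -/
def HasAsymptoticRandomProjection {X : Type*} [MetricSpace X] {x₀ : X} (M : ℕ → Set X)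
    (hM : ∀ n, x₀ ∈ M n) (K : ℝ) : Prop :=
  ∃ υ : (n : ℕ) → X → FreeSpace (M n) ⟨x₀, hM n⟩,
    (∀ x ∈ ⋃ n, M n, Tendsto
      (fun n => FreeSpace.W₁ (FreeSpace.incl (M n) (hM n) (υ n x)) (FreeSpace.delta x₀ x))
      atTop (𝓝 0)) ∧
    ∀ (x y : X) (n : ℕ), FreeSpace.W₁ (υ n x) (υ n y) ≤ K * dist x y

/-- The finite set `{x 0, x 1, …, x n}`. -/
def initialSet {X : Type*} (x : ℕ → X) (n : ℕ) : Set X := {y | ∃ i ≤ n, x i = y}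

theorem base_mem_initialSet {X : Type*} {x : ℕ → X} {x₀ : X} (h : x 0 = x₀) (n : ℕ) :
    x₀ ∈ initialSet x n := ⟨0, Nat.zero_le n, h⟩

end

/-! The free space linearises Lipschitz maps: a `K`-Lipschitz map `X → 𝓕(Y)` vanishing at the base
point extends to an operator `𝓕(X) → 𝓕(Y)` of norm at most `K` (`exists_lift`), and McShane
extension makes `𝓕(M) → 𝓕(X)` isometric (`inclLI`). So a random projection on `M n` is, up to a
translation, an operator on `𝓕(X)` of norm at most `K` with range in the finite-dimensional `𝓕(M
n)`, and condition (i) is convergence to the identity on Dirac functionals with dense span.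

From (b) to (a), the uniform norm bound upgrades this convergence to all vectors, then to uniform
convergence on compact sets.

From (a) to (b), the range of an approximating operator must be moved into the span of the Diracs
over some `M n`. A small perturbation does this, and rescaling restores the bound `K` exactly
(`HasBAP.exists_range_subset`). A diagonal choice (`exists_tendsto_atTop_of_forall_eventually`)
yields operators `T n`, and `υ n x` is the preimage of `T n (δ x)` in `𝓕(M n)`. -/

namespace LipZero

variable {X : Type*} [MetricSpace X] {x₀ : X}

theorem norm_evalDual_sub_le (x y : X) : ‖evalDual x₀ x - evalDual x₀ y‖ ≤ dist x y := by
  refine ContinuousLinearMap.opNorm_le_bound _ dist_nonneg fun f => ?_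
  rw [mul_comm]
  exact abs_sub_le f x y

/-- McShane extension of Lipschitz functions vanishing at the base point. -/
theorem exists_restrict_eq (M : Set X) (hM : x₀ ∈ M) (f : LipZero M ⟨x₀, hM⟩) :
    ∃ g : LipZero X x₀, restrict M hM g = f ∧ ‖g‖ ≤ ‖f‖ := by
  classical
  let F : X → ℝ := fun y => if h : y ∈ M then f ⟨y, h⟩ else 0
  have hF : ∀ y : M, F y = f y := fun y => by simp [F]
  have hL : LipschitzOnWith ‖f‖₊ F M := by
    refine LipschitzOnWith.of_dist_le_mul fun a ha b hb => ?_
    rw [hF ⟨a, ha⟩, hF ⟨b, hb⟩, Real.dist_eq]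
    exact abs_sub_le f ⟨a, ha⟩ ⟨b, hb⟩
  obtain ⟨g, hg, hgF⟩ := hL.extend_real
  have hg' : ∀ a b, |g a - g b| ≤ ‖f‖ * dist a b := fun a b => by
    simpa [Real.dist_eq] using hg.dist_le_mul a b
  refine ⟨⟨g, ?_, _, hg'⟩, ?_, norm_le_of (norm_nonneg' f) hg'⟩
  · rw [← hgF hM, hF ⟨x₀, hM⟩]
    exact apply_base f
  · refine ext_fun fun y => ?_
    exact (hgF y.2).symm.trans (hF y)

/-- Passing to the dual, this makes `𝓕(M n)` finite-dimensional, which is the source of finite rank.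
-/
instance [Finite X] : FiniteDimensional ℝ (LipZero X x₀) :=
  inferInstanceAs (FiniteDimensional ℝ (lipZeroSubmodule x₀))

end LipZero

/-! ### Approximation of the identity by bounded operators -/

section Operators

variable {E : Type*} [NormedAddCommGroup E] [NormedSpace ℝ E]

/-- A uniformly bounded sequence of operators converging to the identity on a set with dense span
converges to the identity pointwise. -/
theorem tendsto_apply_of_dense_span {T : ℕ → E →L[ℝ] E} {K : ℝ} (hT : ∀ n, ‖T n‖ ≤ K)
    {A : Set E} (hA : Dense (Submodule.span ℝ A : Set E))
    (h : ∀ a ∈ A, Tendsto (fun n => T n a) atTop (𝓝 a)) (v : E) :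
    Tendsto (fun n => T n v) atTop (𝓝 v) := by
  have hK : 0 ≤ K := (norm_nonneg _).trans (hT 0)
  have hspan : ∀ w ∈ Submodule.span ℝ A, Tendsto (fun n => T n w) atTop (𝓝 w) := by
    intro w hw
    induction hw using Submodule.span_induction with
    | mem a ha => exact h a ha
    | zero => simp
    | add a b _ _ ha hb => simpa using ha.add hb
    | smul c a _ ha => simpa using ha.const_smul c
  rw [Metric.tendsto_atTop]
  intro ε hε
  -- Replacing `v` by `w` costs at most `(K + 1) * dist v w`, which this radius keeps below `ε / 2`.
  obtain ⟨w, hw, hvw⟩ := Metric.dense_iff.1 hA v (ε / (2 * (K + 1))) (by positivity)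
  obtain ⟨N, hN⟩ := Metric.tendsto_atTop.1 (hspan w hvw) (ε / 2) (by positivity)
  refine ⟨N, fun n hn => ?_⟩
  rw [Metric.mem_ball, lt_div_iff₀ (by positivity)] at hw
  have h1 : dist (T n v) (T n w) ≤ K * dist v w := by
    rw [dist_eq_norm, dist_eq_norm, ← map_sub]
    exact (T n).le_of_opNorm_le (hT n) _
  have h2 := dist_triangle4 (T n v) (T n w) w v
  have h3 := hN n hn
  have h4 := dist_comm v w
  rw [h4] at h1
  nlinarith

/-- A uniformly bounded sequence of operators converging to the identity pointwise converges
uniformly on compact sets. -/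
theorem eventually_forall_mem_norm_sub_le {T : ℕ → E →L[ℝ] E} {K : ℝ} (hT : ∀ n, ‖T n‖ ≤ K)
    (h : ∀ v, Tendsto (fun n => T n v) atTop (𝓝 v)) {S : Set E} (hS : IsCompact S)
    {ε : ℝ} (hε : 0 < ε) : ∀ᶠ n in atTop, ∀ v ∈ S, ‖T n v - v‖ ≤ ε := by
  have hK : 0 ≤ K := (norm_nonneg _).trans (hT 0)
  obtain ⟨t, -, ht, hSt⟩ := hS.finite_cover_balls (e := ε / (2 * (K + 1))) (by positivity)
  have hev : ∀ᶠ n in atTop, ∀ w ∈ t, dist (T n w) w < ε / 2 :=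
    (eventually_all_finite ht).2 fun w _ =>
      (h w).eventually (Metric.ball_mem_nhds w (by positivity))
  filter_upwards [hev] with n hn v hv
  obtain ⟨w, hwt, hw⟩ := Set.mem_iUnion₂.1 (hSt hv)
  rw [Metric.mem_ball, lt_div_iff₀ (by positivity)] at hw
  have h1 : dist (T n v) (T n w) ≤ K * dist v w := by
    rw [dist_eq_norm, dist_eq_norm, ← map_sub]
    exact (T n).le_of_opNorm_le (hT n) _
  have h2 := dist_triangle4 (T n v) (T n w) w v
  have h3 := hn w hwt
  rw [dist_comm w v] at h2
  rw [← dist_eq_norm]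
  nlinarith

/-- A finite-dimensional subspace can be moved into an increasing union of subspaces with dense
union by a small perturbation of the identity. -/
theorem exists_perturbation_of_dense_iUnion (R : Submodule ℝ E) [FiniteDimensional ℝ R]
    {V : ℕ → Submodule ℝ E} (hV : Monotone V) (hd : Dense (⋃ n, (V n : Set E)))
    {η : ℝ} (hη : 0 < η) :
    ∃ (A : R →L[ℝ] E) (n : ℕ), (∀ r, A r ∈ V n) ∧ ∀ r, ‖A r - r‖ ≤ η * ‖r‖ := by
  let b := Module.finBasis ℝ R
  -- An operator on `R` bounded by `η / C` on the basis has norm at most `η`, so it suffices to move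
  -- the basis vectors.
  obtain ⟨C, hC, hb⟩ := b.exists_opNorm_le (F := E)
  have hex : ∀ i, ∃ e : E, (∃ n, e ∈ V n) ∧ ‖e - b i‖ ≤ η / C := by
    intro i
    obtain ⟨e, he, hn⟩ := Metric.dense_iff.1 hd (b i) (η / C) (by positivity)
    refine ⟨e, by simpa using hn, ?_⟩
    rw [← dist_eq_norm]
    exact (Metric.mem_ball.1 he).le
  choose e he hclose using hex
  choose m hm using he
  let A : R →L[ℝ] E := LinearMap.toContinuousLinearMap (b.constr ℝ e)
  have hAb : ∀ i, A (b i) = e i := fun i => b.constr_basis ℝ e i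
  refine ⟨A, Finset.univ.sup m, fun r => ?_, fun r => ?_⟩
  · change b.constr ℝ e r ∈ _
    rw [Module.Basis.constr_apply_fintype]
    exact Submodule.sum_mem _ fun i _ =>
      Submodule.smul_mem _ _ (hV (Finset.le_sup (Finset.mem_univ i)) (hm i))
  · have hn : ‖A - R.subtypeL‖ ≤ C * (η / C) := by
      refine hb (by positivity) fun i => ?_
      rw [_root_.sub_apply, hAb]
      exact hclose i
    rw [mul_div_cancel₀ _ hC.ne'] at hn
    exact (A - R.subtypeL).le_of_opNorm_le hn r

/-- The bounded approximation property allows to approximate the identity on finite sets by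
operators of norm at most `K` with range in a member of a given increasing sequence of subspaces
with dense union. -/
theorem HasBAP.exists_range_subset {K : ℝ} (h : HasBAP E K) (hK : 0 ≤ K)
    {V : ℕ → Submodule ℝ E} (hV : Monotone V) (hd : Dense (⋃ n, (V n : Set E)))
    {S : Set E} (hS : S.Finite) {ε : ℝ} (hε : 0 < ε) :
    ∃ (T : E →L[ℝ] E) (n : ℕ), (∀ v, T v ∈ V n) ∧ ‖T‖ ≤ K ∧ ∀ v ∈ S, ‖T v - v‖ ≤ ε := by
  obtain ⟨T, hfin, hTK, hT⟩ := h (ε / 2) (by positivity) S hS.isCompact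
  obtain ⟨B, hB⟩ := hS.isBounded.exists_norm_le
  -- Chosen so that the perturbation error `η * K * ‖v‖` and the rescaling error `η * ‖v‖` together
  -- stay below `ε / 2` on `S`.
  set η : ℝ := ε / (2 * (K + 1) * (|B| + 1)) with hη_def
  have hη : 0 < η := by positivity
  obtain ⟨A, n, hAn, hA⟩ := exists_perturbation_of_dense_iUnion
    (LinearMap.range (T : E →ₗ[ℝ] E)) hV hd hη
  let T' : E →L[ℝ] E := A.comp (T.codRestrict _ fun v => LinearMap.mem_range_self _ v)
  have hT' : ∀ v, ‖T' v - T v‖ ≤ η * (K * ‖v‖) := fun v =>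
    (hA _).trans (mul_le_mul_of_nonneg_left (T.le_of_opNorm_le hTK v) hη.le)
  have hη1 : 0 < 1 + η := by positivity
  -- The perturbed operator has norm at most `(1 + η) * K`; the scalar factor brings this back to
  -- `K` and keeps the range in `V n`.
  refine ⟨(1 + η)⁻¹ • T', n, fun v => Submodule.smul_mem _ _ (hAn _), ?_, fun v hv => ?_⟩
  · refine ContinuousLinearMap.opNorm_le_bound _ hK fun v => ?_
    rw [_root_.smul_apply, norm_smul, norm_inv, Real.norm_of_nonneg hη1.le,
      inv_mul_le_iff₀ hη1]
    have h1 : ‖T' v‖ ≤ ‖T' v - T v‖ + ‖T v‖ := by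
      simpa using norm_add_le (T' v - T v) (T v)
    have h2 := hT' v
    have h3 := T.le_of_opNorm_le hTK v
    linarith
  · have heq : ((1 + η)⁻¹ • T') v - v = (1 + η)⁻¹ • ((T' v - T v) + (T v - v) - η • v) := by
      rw [_root_.smul_apply]
      have : v = (1 + η)⁻¹ • ((1 + η) • v) := (inv_smul_smul₀ hη1.ne' v).symm
      nth_rewrite 2 [this]
      rw [← smul_sub, add_smul, one_smul]
      congr 1
      abel
    have hvB : ‖v‖ ≤ |B| + 1 := ((hB v hv).trans (le_abs_self B)).trans (by linarith)
    have hηε : η * (K + 1) * (|B| + 1) = ε / 2 := by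
      rw [hη_def]
      field_simp
    have hsmall : η * (K + 1) * ‖v‖ ≤ ε / 2 := by
      rw [← hηε]
      exact mul_le_mul_of_nonneg_left hvB (by positivity)
    have h1 := norm_sub_le ((T' v - T v) + (T v - v)) (η • v)
    have h2 := norm_add_le (T' v - T v) (T v - v)
    have h3 := hT' v
    have h4 := hT v hv
    rw [norm_smul, Real.norm_of_nonneg hη.le] at h1
    rw [heq, norm_smul, norm_inv, Real.norm_of_nonneg hη1.le, inv_mul_le_iff₀ hη1]
    nlinarith

end Operators

/-- Diagonal selection: if each of countably many properties, decreasing in strength, holds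
eventually, then along the sequence a property of index tending to infinity can be selected. -/
theorem exists_tendsto_atTop_of_forall_eventually {P : ℕ → ℕ → Prop} (h0 : ∀ n, P 0 n)
    (h : ∀ k, ∀ᶠ n in atTop, P k n) :
    ∃ k : ℕ → ℕ, Tendsto k atTop atTop ∧ ∀ n, P (k n) n := by
  classical
  -- The cap `k ≤ n` guarantees a greatest valid index, and `P 0 n` that there is one.
  refine ⟨fun n => Nat.findGreatest (fun k => P k n) n, ?_, fun n =>
    Nat.findGreatest_spec (P := fun k => P k n) (Nat.zero_le n) (h0 n)⟩
  rw [tendsto_atTop]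
  intro k
  filter_upwards [h k, eventually_ge_atTop k] with n hn hkn
  exact Nat.le_findGreatest hkn hn

/-! ### Dirac functionals and isometric inclusions of free spaces -/

namespace FreeSpace

variable {X : Type*} [MetricSpace X] {x₀ : X}

noncomputable local instance : NormedAddCommGroup (FreeSpace X x₀) := inferInstance

noncomputable local instance : NormedSpace ℝ (FreeSpace X x₀) := inferInstance

noncomputable local instance : SeminormedAddCommGroup (FreeSpace X x₀) :=
  NormedAddCommGroup.toSeminormedAddCommGroup

noncomputable local instance : AddCommGroup (FreeSpace X x₀) :=
  NormedAddCommGroup.toAddCommGroup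

noncomputable local instance : AddCommMonoid (FreeSpace X x₀) :=
  AddCommGroup.toAddCommMonoid

noncomputable local instance : Module ℝ (FreeSpace X x₀) := NormedSpace.toModule

noncomputable local instance : PseudoMetricSpace (FreeSpace X x₀) :=
  SeminormedAddCommGroup.toPseudoMetricSpace

noncomputable local instance : TopologicalSpace (FreeSpace X x₀) :=
  UniformSpace.toTopologicalSpace

theorem norm_delta_sub_le (x y : X) : ‖delta x₀ x - delta x₀ y‖ ≤ dist x y :=
  LipZero.norm_evalDual_sub_le x y

theorem continuous_delta : Continuous (delta x₀) :=
  (LipschitzWith.of_dist_le_mul (K := 1) fun x y => by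
    rw [NNReal.coe_one, one_mul, dist_eq_norm]
    exact norm_delta_sub_le x y).continuous

theorem delta_base : delta x₀ x₀ = 0 :=
  Subtype.ext (ContinuousLinearMap.ext fun f => f.apply_base)

theorem dense_span_range_delta :
    Dense (Submodule.span ℝ (Set.range (delta x₀)) : Set (FreeSpace X x₀)) := by
  intro μ
  rw [closure_subtype]
  have hμ : μ.1 ∈ closure
      (Submodule.span ℝ (Set.range (LipZero.evalDual x₀)) : Set _) := μ.2
  refine closure_mono ?_ hμ
  have h : (Submodule.span ℝ (Set.range (delta x₀))).map (Submodule.subtype _) =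
      Submodule.span ℝ (Set.range (LipZero.evalDual x₀)) := by
    rw [Submodule.map_span, ← Set.range_comp]
    rfl
  exact fun ν hν => (h.symm ▸ hν :)

theorem dense_span_delta_comp {ι : Type*} {x : ι → X} (hx : DenseRange x) :
    Dense (Submodule.span ℝ (Set.range fun i => delta x₀ (x i)) : Set (FreeSpace X x₀)) := by
  rw [Submodule.dense_iff_topologicalClosure_eq_top, eq_top_iff,
    ← Submodule.dense_iff_topologicalClosure_eq_top.1 dense_span_range_delta]
  refine Submodule.topologicalClosure_minimal _ (Submodule.span_le.2 ?_)
    (Submodule.isClosed_topologicalClosure _)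
  rintro _ ⟨y, rfl⟩
  refine map_mem_closure continuous_delta (hx y) ?_
  rintro _ ⟨i, rfl⟩
  exact Submodule.subset_span ⟨i, rfl⟩

/-- The canonical map `𝓕(M) → 𝓕(X)` as a linear isometry. -/
noncomputable def inclLI (M : Set X) (hM : x₀ ∈ M) :
    FreeSpace M ⟨x₀, hM⟩ →ₗᵢ[ℝ] FreeSpace X x₀ where
  toFun := incl M hM
  map_add' _ _ := rfl
  map_smul' _ _ := rfl
  norm_map' μ := by
    refine le_antisymm ?_ ?_
    · refine ContinuousLinearMap.opNorm_le_bound _ (norm_nonneg μ) fun f => ?_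
      refine (μ.1.le_opNorm _).trans ?_
      refine mul_le_mul_of_nonneg_left ?_ (norm_nonneg _)
      exact LipZero.norm_le_of (norm_nonneg f) fun a b => LipZero.abs_sub_le f a.1 b.1
    · refine ContinuousLinearMap.opNorm_le_bound μ.1 (norm_nonneg (incl M hM μ)) fun f => ?_
      -- Every test function on `M` is the restriction of one on `X` of no larger norm, so testing
      -- on `X` loses nothing.
      obtain ⟨g, rfl, hg⟩ := LipZero.exists_restrict_eq M hM f
      exact ((incl M hM μ).1.le_opNorm g).trans
        (mul_le_mul_of_nonneg_left hg (norm_nonneg (incl M hM μ)))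

@[simp] theorem inclLI_apply (M : Set X) (hM : x₀ ∈ M) (μ : FreeSpace M ⟨x₀, hM⟩) :
    inclLI M hM μ = incl M hM μ := rfl

theorem span_delta_image_le_range (M : Set X) (hM : x₀ ∈ M) :
    Submodule.span ℝ (delta x₀ '' M) ≤ LinearMap.range (inclLI M hM).toLinearMap := by
  rw [Submodule.span_le]
  rintro _ ⟨y, hy, rfl⟩
  exact LinearMap.mem_range.2 ⟨delta (⟨x₀, hM⟩ : M) ⟨y, hy⟩, rfl⟩

/-! ### Linearisation of Lipschitz maps -/

variable {Y : Type*} [MetricSpace Y] {y₀ : Y} {K : ℝ}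

theorem abs_apply_sub_apply_le {φ : X → FreeSpace Y y₀}
    (hφ : ∀ x y, ‖φ x - φ y‖ ≤ K * dist x y) (f : LipZero Y y₀) (x y : X) :
    |(φ x).1 f - (φ y).1 f| ≤ K * ‖f‖ * dist x y := by
  calc |(φ x).1 f - (φ y).1 f| ≤ ‖φ x - φ y‖ * ‖f‖ := (φ x - φ y).1.le_opNorm f
    _ ≤ K * dist x y * ‖f‖ := mul_le_mul_of_nonneg_right (hφ x y) (norm_nonneg f)
    _ = K * ‖f‖ * dist x y := by ring

/-- A Lipschitz map `φ : X → 𝓕(Y)` vanishing at the base point induces the operator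
`f ↦ (x ↦ φ x f)` from `Lip₀(Y)` to `Lip₀(X)`. -/
theorem exists_liftAdjoint {φ : X → FreeSpace Y y₀} (h0 : φ x₀ = 0) (hK : 0 ≤ K)
    (hφ : ∀ x y, ‖φ x - φ y‖ ≤ K * dist x y) :
    ∃ A : LipZero Y y₀ →L[ℝ] LipZero X x₀, ‖A‖ ≤ K ∧ ∀ f x, A f x = (φ x).1 f := by
  have hbase : ∀ f, (φ x₀).1 f = 0 := fun f => by rw [h0]; rfl
  let L : LipZero Y y₀ →ₗ[ℝ] LipZero X x₀ :=
    { toFun := fun f => ⟨fun x => (φ x).1 f, hbase f, _, abs_apply_sub_apply_le hφ f⟩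
      map_add' := fun f g => LipZero.ext_fun fun x => map_add (φ x).1 f g
      map_smul' := fun c f => LipZero.ext_fun fun x => map_smul (φ x).1 c f }
  have hL : ∀ f, ‖L f‖ ≤ K * ‖f‖ := fun f =>
    LipZero.norm_le_of (mul_nonneg hK (norm_nonneg f)) (abs_apply_sub_apply_le hφ f)
  exact ⟨L.mkContinuous K hL, L.mkContinuous_norm_le hK hL, fun f x => rfl⟩

/-- Every `K`-Lipschitz map `X → 𝓕(Y)` vanishing at the base point extends to a bounded linear
operator `𝓕(X) → 𝓕(Y)` of norm at most `K`. -/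
theorem exists_lift (φ : X → FreeSpace Y y₀) (h0 : φ x₀ = 0) (hK : 0 ≤ K)
    (hφ : ∀ x y, ‖φ x - φ y‖ ≤ K * dist x y) :
    ∃ T : FreeSpace X x₀ →L[ℝ] FreeSpace Y y₀, ‖T‖ ≤ K ∧ ∀ x, T (delta x₀ x) = φ x := by
  obtain ⟨A, hAK, hA⟩ := exists_liftAdjoint h0 hK hφ
  let Φ : StrongDual ℝ (LipZero X x₀) →L[ℝ] StrongDual ℝ (LipZero Y y₀) :=
    (ContinuousLinearMap.compL ℝ (LipZero Y y₀) (LipZero X x₀) ℝ).flip A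
  have hmaps : ∀ μ : FreeSpace X x₀, Φ μ.1 ∈
      (Submodule.span ℝ (Set.range (LipZero.evalDual y₀))).topologicalClosure := by
    have hle : (Submodule.span ℝ (Set.range (LipZero.evalDual x₀))).topologicalClosure ≤
        ((Submodule.span ℝ (Set.range (LipZero.evalDual y₀))).topologicalClosure).comap
          Φ.toLinearMap := by
      -- The adjoint of `A` sends `δ x` to `φ x`, which lies in the closed subspace `𝓕(Y)`; by
      -- linearity and continuity all of `𝓕(X)` goes there.
      refine Submodule.topologicalClosure_minimal _ (Submodule.span_le.2 ?_)
        ((Submodule.isClosed_topologicalClosure _).preimage Φ.continuous)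
      rintro _ ⟨x, rfl⟩
      rw [SetLike.mem_coe, Submodule.mem_comap]
      have h : Φ (LipZero.evalDual x₀ x) = (φ x).1 := ContinuousLinearMap.ext fun f => hA f x
      exact h ▸ (φ x).2
    exact fun μ => hle μ.2
  refine ⟨(Φ.comp (Submodule.subtypeL _)).codRestrict _ hmaps, ?_, fun x =>
    Subtype.ext (ContinuousLinearMap.ext fun f => hA f x)⟩
  refine ContinuousLinearMap.opNorm_le_bound _ hK fun μ => ?_
  calc ‖μ.1.comp A‖ ≤ ‖μ.1‖ * ‖A‖ := ContinuousLinearMap.opNorm_comp_le _ _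
    _ ≤ ‖μ.1‖ * K :=
      mul_le_mul_of_nonneg_left hAK (norm_nonneg _)
    _ = K * ‖μ‖ := mul_comm _ _

theorem hasBAP_of_hasAsymptoticRandomProjection {M : ℕ → Set X} {hM : ∀ n, x₀ ∈ M n} {K : ℝ}
    (hfin : ∀ n, (M n).Finite) (hd : Dense (⋃ n, M n)) (hK : 0 ≤ K)
    (h : HasAsymptoticRandomProjection M hM K) : HasBAP (FreeSpace X x₀) K := by
  obtain ⟨υ, hlim, hLip⟩ := h
  simp only [W₁_eq_norm] at hlim hLip
  have hlim' : ∀ y ∈ ⋃ n, M n,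
      Tendsto (fun n => inclLI (M n) (hM n) (υ n y)) atTop (𝓝 (delta x₀ y)) := fun y hy =>
    tendsto_iff_norm_sub_tendsto_zero.2 (hlim y hy)
  have hbase : x₀ ∈ ⋃ n, M n := Set.mem_iUnion.2 ⟨0, hM 0⟩
  -- `υ n x₀` need not vanish, so it is subtracted. The correction tends to `δ x₀ = 0`, hence does
  -- not affect the limit.
  choose L hLK hLδ using fun n => exists_lift (x₀ := x₀) (fun y => υ n y - υ n x₀)
    (sub_self _) hK (fun y z => by simpa using hLip y z n)
  let T : ℕ → FreeSpace X x₀ →L[ℝ] FreeSpace X x₀ := fun n =>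
    (inclLI (M n) (hM n)).toContinuousLinearMap.comp (L n)
  have hTK : ∀ n, ‖T n‖ ≤ K := fun n =>
    ContinuousLinearMap.opNorm_le_bound _ hK fun μ => by
      change ‖inclLI (M n) (hM n) (L n μ)‖ ≤ _
      rw [LinearIsometry.norm_map]
      exact (L n).le_of_opNorm_le (hLK n) μ
  have hdense := dense_span_delta_comp (x₀ := x₀) (x := ((↑) : (⋃ n, M n) → X))
    (by rwa [DenseRange, Subtype.range_coe])
  have hT : ∀ μ, Tendsto (fun n => T n μ) atTop (𝓝 μ) := by
    refine tendsto_apply_of_dense_span hTK hdense ?_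
    rintro _ ⟨y, rfl⟩
    have h1 := (hlim' y y.2).sub (hlim' x₀ hbase)
    rw [delta_base, sub_zero] at h1
    refine h1.congr fun n => ?_
    change _ = inclLI (M n) (hM n) (L n (delta x₀ y))
    rw [hLδ, map_sub]
  intro ε hε S hS
  obtain ⟨n, hn⟩ := (eventually_forall_mem_norm_sub_le hTK hT hS hε).exists
  refine ⟨T n, ?_, hTK n, hn⟩
  have := (hfin n).to_subtype
  exact Submodule.finiteDimensional_of_le
    (LinearMap.range_comp_le_range (L n).toLinearMap (inclLI (M n) (hM n)).toLinearMap)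

theorem hasAsymptoticRandomProjection_of_hasBAP {M : ℕ → Set X} (hM : ∀ n, x₀ ∈ M n) {K : ℝ}
    (hfin : ∀ n, (M n).Finite) (hmono : Monotone M) (hd : Dense (⋃ n, M n)) (hK : 0 ≤ K)
    (h : HasBAP (FreeSpace X x₀) K) : HasAsymptoticRandomProjection M hM K := by
  let V : ℕ → Submodule ℝ (FreeSpace X x₀) := fun n => Submodule.span ℝ (delta x₀ '' M n)
  have hV : Monotone V := fun m n hmn => Submodule.span_mono (Set.image_mono (hmono hmn))
  have hVd : Dense (⋃ n, (V n : Set (FreeSpace X x₀))) := by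
    have hdense := dense_span_delta_comp (x₀ := x₀) (x := ((↑) : (⋃ n, M n) → X))
      (by rwa [DenseRange, Subtype.range_coe])
    refine hdense.mono ?_
    rw [← Submodule.coe_iSup_of_directed V hV.directed_le]
    refine Submodule.span_le.2 ?_
    rintro _ ⟨⟨y, hy⟩, rfl⟩
    obtain ⟨n, hn⟩ := Set.mem_iUnion.1 hy
    exact Submodule.mem_iSup_of_mem n (Submodule.subset_span ⟨y, hn, rfl⟩)
  -- The guard `k ≠ 0` makes the zero operator a witness at level `0` for every `n`; it is harmless
  -- since `k n` tends to infinity.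
  obtain ⟨k, hk, hP⟩ := exists_tendsto_atTop_of_forall_eventually
    (P := fun k n => ∃ T : FreeSpace X x₀ →L[ℝ] FreeSpace X x₀, (∀ μ, T μ ∈ V n) ∧ ‖T‖ ≤ K ∧
      (k ≠ 0 → ∀ y ∈ M k, ‖T (delta x₀ y) - delta x₀ y‖ ≤ 1 / (k + 1 : ℝ)))
    (fun n => ⟨0, fun _ => zero_mem _, by simpa using hK, by simp⟩) (fun k => by
      obtain ⟨T, m, hTm, hTK, hT⟩ := h.exists_range_subset hK hV hVd
        ((hfin k).image (delta x₀)) (ε := 1 / (k + 1 : ℝ)) (by positivity)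
      filter_upwards [eventually_ge_atTop m] with n hn
      exact ⟨T, fun μ => hV hn (hTm μ), hTK, fun _ y hy => hT _ ⟨y, hy, rfl⟩⟩)
  choose T hTV hTK hT using hP
  choose υ hυ using fun n y => span_delta_image_le_range (M n) (hM n) (hTV n (delta x₀ y))
  have hυ' : ∀ n y, inclLI (M n) (hM n) (υ n y) = T n (delta x₀ y) := hυ
  refine ⟨υ, fun y hy => ?_, fun y z n => ?_⟩
  · simp only [W₁_eq_norm]
    obtain ⟨m, hm⟩ := Set.mem_iUnion.1 hy
    refine squeeze_zero' (Eventually.of_forall fun n => norm_nonneg _) ?_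
      ((tendsto_one_div_add_atTop_nhds_zero_nat (𝕜 := ℝ)).comp hk)
    filter_upwards [hk.eventually_ge_atTop m, hk.eventually_ge_atTop 1] with n hn hn1
    rw [← inclLI_apply, hυ']
    exact hT n (by omega) y (hmono hn hm)
  -- The isometry turns the distance in `𝓕(M n)` into one in `𝓕(X)`, where `‖T n‖ ≤ K` applies.
  · rw [W₁_eq_norm, ← (inclLI (M n) (hM n)).norm_map, map_sub, hυ', hυ', ← map_sub]
    exact ((T n).le_of_opNorm_le (hTK n) _).trans
      (mul_le_mul_of_nonneg_left (norm_delta_sub_le y z) hK)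

end FreeSpace

theorem initialSet_mono {X : Type*} (x : ℕ → X) : Monotone (initialSet x) :=
  fun _ _ hmn _ ⟨i, hi, h⟩ => ⟨i, hi.trans hmn, h⟩

theorem finite_initialSet {X : Type*} (x : ℕ → X) (n : ℕ) : (initialSet x n).Finite :=
  (Set.finite_Iic n).image x

theorem mem_initialSet {X : Type*} (x : ℕ → X) {i n : ℕ} (h : i ≤ n) : x i ∈ initialSet x n :=
  ⟨i, h, rfl⟩

theorem mainTheorem2 {X : Type*} [MetricSpace X] [TopologicalSpace.SeparableSpace X]
    (x₀ : X) (x : ℕ → X) (hdense : DenseRange x) (h0 : x 0 = x₀) (K : ℝ) (hK : 1 ≤ K) :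
    HasBAP (FreeSpace X x₀) K ↔
      HasAsymptoticRandomProjection (initialSet x) (base_mem_initialSet h0) K := by
  have hd : Dense (⋃ n, initialSet x n) := by
    refine Dense.mono ?_ hdense
    rintro _ ⟨i, rfl⟩
    exact Set.mem_iUnion.2 ⟨i, mem_initialSet x le_rfl⟩
  have hK0 : 0 ≤ K := zero_le_one.trans hK
  exact ⟨FreeSpace.hasAsymptoticRandomProjection_of_hasBAP _ (finite_initialSet x) (initialSet_mono x) hd hK0,
    FreeSpace.hasBAP_of_hasAsymptoticRandomProjection (finite_initialSet x) hd hK0⟩
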